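/- Let $K$ be a field, let $R=K[x_1,\dots,x_n]$, and let $I$ be an ideal of $R$ generated by square-free monomials such that $I^2$ is integrally closed, i.e. every $x\in R$ that satisfies an equation $x^m+a_1x^{m-1}+\dots+a_m=0$ with $m\ge 1$ and $a_i\in (I^2)^i$ lies in $I^2$. For an ideal $L$ of $R$ write $\operatorname{Ass}(L)$ for the set of associated primes of the $R$-module $R/L$, and $(L:L')=\{f\in R : fL'\subseteq L\}$. Then for all $k\ge 2$: 1. $(I^k:I^{k-2})=I^2$, provided $I\neq 0$; 2. $\operatorname{Ass}(I^2)\subseteq\operatorname{Ass}(I^k)$. In particular, let $G$ be a finite simple graph on the vertex set $\{x_1,\dots,x_n\}$ and let $J=\bigcap_{\{x_i,x_j\}\in E(G)}\langle x_i,x_j\rangle\subseteq R$ be its vertex cover ideal, i.e. the Alexander dual of the edge ideal $\langle x_ix_j : \{x_i,x_j\}\in E(G)\rangle$ (so $J=R$ if $G$ has no edges). Then, with no further hypothesis, $(J^k:J^{k-2})=J^2$ and $\operatorname{Ass}(J^2)\subseteq\operatorname{Ass}(J^k)$ for all $k\ge 2$. -/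

import Mathlib

open MvPolynomial

/-- The element `x` is integral over the ideal `I`: it satisfies an equation
`x ^ n + a₁ x ^ (n - 1) + ⋯ + aₙ = 0` with `n ≥ 1` and `aᵢ ∈ I ^ i`. -/
def IsIntegralOverIdeal {R : Type*} [CommRing R] (I : Ideal R) (x : R) : Prop :=
  ∃ n : ℕ, 1 ≤ n ∧ ∃ a : ℕ → R, (∀ i ∈ Finset.Icc 1 n, a i ∈ I ^ i) ∧
    x ^ n + ∑ i ∈ Finset.Icc 1 n, a i * x ^ (n - i) = 0

/-- The integral closure of an ideal `I` of `R`: the set of elements of `R` integral over `I`. -/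
def idealIntegralClosure {R : Type*} [CommRing R] (I : Ideal R) : Set R :=
  {x | IsIntegralOverIdeal I x}

/-- An ideal is integrally closed if it equals its integral closure. -/
def IsIntegrallyClosedIdeal {R : Type*} [CommRing R] (I : Ideal R) : Prop :=
  idealIntegralClosure I = (I : Set R)

/-- The square-free monomial `∏ i ∈ s, X i`. -/
noncomputable def sqfreeMonomial {σ : Type*} (K : Type*) [Field K] (s : Finset σ) :
    MvPolynomial σ K :=
  ∏ i ∈ s, X i

/-- An ideal generated by square-free monomials. -/
def IsSquareFreeMonomialIdeal {σ K : Type*} [Field K] (I : Ideal (MvPolynomial σ K)) : Prop :=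
  ∃ S : Set (Finset σ), I = Ideal.span (sqfreeMonomial K '' S)

/-- The Alexander dual of a square-free monomial ideal `I`: the intersection of the ideals
`⟨X i | i ∈ s⟩` over the square-free monomials `∏ i ∈ s, X i` in `I`.  By
`alexanderDual_span` below it suffices to intersect over any generating set of
square-free monomials. -/
noncomputable def alexanderDual {σ K : Type*} [Field K] (I : Ideal (MvPolynomial σ K)) :
    Ideal (MvPolynomial σ K) :=
  ⨅ (s : Finset σ) (_ : sqfreeMonomial K s ∈ I), Ideal.span (X '' (s : Set σ))

/-- The edge ideal `⟨X i * X j | {i, j} an edge of G⟩` of a graph. -/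
noncomputable def edgeIdeal {σ : Type*} (K : Type*) [Field K] (G : SimpleGraph σ) :
    Ideal (MvPolynomial σ K) :=
  Ideal.span {f | ∃ i j : σ, G.Adj i j ∧ f = X i * X j}

/-- The (vertex) cover ideal of a graph: the Alexander dual of its edge ideal. -/
noncomputable def vertexCoverIdeal {σ : Type*} (K : Type*) [Field K] (G : SimpleGraph σ) :
    Ideal (MvPolynomial σ K) :=
  alexanderDual (edgeIdeal K G)

theorem sqfreeMonomial_eq {σ K : Type*} [Field K] (s : Finset σ) :
    sqfreeMonomial K s = monomial (∑ i ∈ s, Finsupp.single i 1) (1 : K) := by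
  rw [sqfreeMonomial, MvPolynomial.monomial_sum_one]
  rfl

theorem sqfreeMonomial_mem_span {σ K : Type*} [Field K] (S : Set (Finset σ)) (s : Finset σ) :
    sqfreeMonomial K s ∈ Ideal.span (sqfreeMonomial K '' S) ↔ ∃ t ∈ S, t ⊆ s := by
  classical
  constructor
  · intro h
    have e : sqfreeMonomial K '' S = (fun d => monomial d (1 : K)) ''
        ((fun t : Finset σ => ∑ i ∈ t, Finsupp.single i 1) '' S) := by
      rw [Set.image_image]
      exact Set.image_congr fun t _ => sqfreeMonomial_eq t
    rw [e, mem_ideal_span_monomial_image] at h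
    obtain ⟨_, ⟨t, ht, rfl⟩, hle⟩ := h (∑ i ∈ s, Finsupp.single i 1)
      (by rw [sqfreeMonomial_eq]; simp [mem_support_iff])
    refine ⟨t, ht, fun i hi => ?_⟩
    have := hle i
    by_contra hs
    simp [Finsupp.finsetSum_apply, Finsupp.single_apply, hi, hs] at this
  · rintro ⟨t, ht, hts⟩
    exact Ideal.mem_of_dvd _ (Finset.prod_dvd_prod_of_subset _ _ _ hts)
      (Ideal.subset_span ⟨t, ht, rfl⟩)

/-- The Alexander dual of `⟨∏ i ∈ s, X i | s ∈ S⟩` is `⋂ s ∈ S, ⟨X i | i ∈ s⟩`. -/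
theorem alexanderDual_span {σ K : Type*} [Field K] (S : Set (Finset σ)) :
    alexanderDual (Ideal.span (sqfreeMonomial K '' S)) =
      ⨅ s ∈ S, Ideal.span (X '' (s : Set σ)) := by
  apply le_antisymm
  · exact le_iInf₂ fun s hs => iInf₂_le s ((sqfreeMonomial_mem_span S s).2 ⟨s, hs, subset_rfl⟩)
  · refine le_iInf₂ fun s hs => ?_
    obtain ⟨t, ht, hts⟩ := (sqfreeMonomial_mem_span S s).1 hs
    exact (iInf₂_le t ht).trans (Ideal.span_mono (Set.image_mono (by exact_mod_cast hts)))

/-- The cover ideal is the intersection of the ideals `⟨X i, X j⟩` over the edges. -/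
theorem vertexCoverIdeal_eq {σ K : Type*} [Field K] (G : SimpleGraph σ) :
    vertexCoverIdeal K G = ⨅ (i : σ) (j : σ) (_ : G.Adj i j), Ideal.span {X i, X j} := by
  classical
  have e : {f : MvPolynomial σ K | ∃ i j : σ, G.Adj i j ∧ f = X i * X j} =
      sqfreeMonomial K '' {s | ∃ i j : σ, G.Adj i j ∧ s = {i, j}} := by
    ext f
    constructor
    · rintro ⟨i, j, h, rfl⟩
      exact ⟨_, ⟨i, j, h, rfl⟩, Finset.prod_pair h.ne⟩
    · rintro ⟨_, ⟨i, j, h, rfl⟩, rfl⟩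
      exact ⟨i, j, h, Finset.prod_pair h.ne⟩
  rw [vertexCoverIdeal, edgeIdeal, e, alexanderDual_span]
  apply le_antisymm
  · refine le_iInf fun i => le_iInf fun j => le_iInf fun h => ?_
    refine (iInf₂_le ({i, j} : Finset σ) ⟨i, j, h, rfl⟩).trans (le_of_eq ?_)
    simp [Set.image_pair]
  · refine le_iInf₂ ?_
    rintro _ ⟨i, j, h, rfl⟩
    refine (iInf_le_of_le i (iInf_le_of_le j (iInf_le _ h))).trans (le_of_eq ?_)
    simp [Set.image_pair]

/-! ### Colons and associated primes of powers of an ideal. -/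

section Ratliff

variable {R : Type*} [CommRing R]

/-! If `x * I^(k-2) ⊆ I^k = I^2 * I^(k-2)`, the determinant trick makes `x` integral over `I^2`,
hence `x ∈ I^2`. This gives the colon formula, and passing to a colon creates no new associated
primes.

For a cover ideal `J`, it remains to see that `J^2` is integrally closed. Let `m` be the exponent of
a monomial in an element integral over `J^2`. Monomial valuations force `m i + m j ≥ 2` on edges and
exclude odd closed walks through vertices of exponent one (`exponentOneGraph_colorable`). A
2-colouring of these vertices then splits `m` into two vertex covers
(`monomial_mem_vertexCoverIdeal_sq`). -/

theorem subset_idealIntegralClosure (I : Ideal R) : (I : Set R) ⊆ idealIntegralClosure I := by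
  intro x hx
  refine ⟨1, le_rfl, fun _ => -x, ?_, by simp⟩
  intro i hi
  obtain rfl : i = 1 := by simpa using hi
  simpa using hx

/-- The determinant trick: multiplying a faithful finitely generated ideal `N` into `I * N`
forces integrality over `I`. -/
theorem isIntegralOverIdeal_of_mul_mem [IsDomain R] {I N : Ideal R} (hN : N.FG) (hN0 : N ≠ ⊥)
    {x : R} (h : ∀ g ∈ N, x * g ∈ I * N) : IsIntegralOverIdeal I x := by
  have : Module.Finite R N := Module.Finite.of_fg hN
  have hr : LinearMap.range (LinearMap.lsmul R N x) ≤ I • ⊤ := by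
    rintro _ ⟨g, rfl⟩
    have hIN : (I • ⊤ : Submodule R N).map N.subtype = I * N := by
      rw [Submodule.map_smul'', Submodule.map_subtype_top, smul_eq_mul]
    obtain ⟨y, hy, e⟩ := hIN.ge (h g g.2)
    have : y = LinearMap.lsmul R N x g := Subtype.ext e
    exact this ▸ hy
  obtain ⟨p, hp, -, hc, h0⟩ :=
    LinearMap.exists_monic_and_natDegree_eq_and_coeff_mem_pow_and_aeval_eq_zero R
      (LinearMap.lsmul R N x : Module.End R N) I hr
  obtain ⟨g, hg, hg0⟩ := Submodule.exists_mem_ne_zero_of_ne_bot hN0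
  -- `p` annihilates multiplication by `x` on `N`; apply it to `g ≠ 0` and cancel in the domain.
  have hx : p.eval x = 0 := by
    have e : Polynomial.aeval (LinearMap.lsmul R N x : Module.End R N) p =
        LinearMap.lsmul R N (p.eval x) := by
      have := Polynomial.aeval_algHom_apply (Algebra.ofId R (Module.End R N)) x p
      exact this
    rw [e] at h0
    have := congrArg Subtype.val (LinearMap.congr_fun h0 ⟨g, hg⟩)
    exact (mul_eq_zero.1 this).resolve_right hg0
  have hd : 1 ≤ p.natDegree := by
    by_contra hd
    rw [hp.natDegree_eq_zero.1 (by omega)] at hx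
    simp at hx
  refine ⟨p.natDegree, hd, fun i => p.coeff (p.natDegree - i), ?_, ?_⟩
  · intro i hi
    have := hc (p.natDegree - i)
    rwa [Nat.sub_sub_self (Finset.mem_Icc.1 hi).2] at this
  · rw [Polynomial.eval_eq_sum_range, Finset.sum_range_succ, hp.coeff_natDegree, one_mul] at hx
    rw [← hx, add_comm]
    congr 1
    refine Finset.sum_bij' (fun i _ => p.natDegree - i) (fun i _ => p.natDegree - i) ?_ ?_ ?_ ?_ ?_
    all_goals intro i hi; simp only [Finset.mem_Icc, Finset.mem_range] at hi ⊢
    all_goals omega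

theorem IsIntegrallyClosedIdeal.pow_colon_pow [IsDomain R] [IsNoetherianRing R] {I : Ideal R}
    {d : ℕ} (hI : IsIntegrallyClosedIdeal (I ^ d)) (hI0 : I ≠ ⊥) {k : ℕ} (hk : d ≤ k) :
    (I ^ k).colon ((I ^ (k - d) : Ideal R) : Set R) = I ^ d := by
  have e : I ^ k = I ^ d * I ^ (k - d) := by rw [← pow_add, Nat.add_sub_cancel' hk]
  ext x
  rw [Submodule.mem_colon]
  constructor
  · intro h
    rw [← SetLike.mem_coe, ← hI]
    exact isIntegralOverIdeal_of_mul_mem (IsNoetherian.noetherian _) (pow_ne_zero _ hI0)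
      fun g hg => e ▸ h g hg
  · intro hx g hg
    rw [e]
    exact Ideal.mul_mem_mul hx hg

theorem mem_associatedPrimes_quotient_iff [IsNoetherianRing R] {L P : Ideal R} :
    P ∈ associatedPrimes R (R ⧸ L) ↔ P.IsPrime ∧ ∃ f : R, ∀ r, r ∈ P ↔ r * f ∈ L := by
  rw [AssociatedPrimes.mem_iff, isAssociatedPrime_iff]
  refine and_congr_right fun _ => ?_
  rw [(Ideal.Quotient.mk_surjective (I := L)).exists]
  refine exists_congr fun f => ?_
  rw [SetLike.ext_iff]
  refine forall_congr' fun r => ?_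
  rw [Submodule.mem_colon_singleton, Submodule.mem_bot, ← Ideal.Quotient.eq_zero_iff_mem (I := L)]
  rfl

/-- An annihilator modulo `L : N` is the finite intersection of the `L : f * g` over generators `g`
of `N`; a prime that is a finite intersection equals one of its members. -/
theorem associatedPrimes_quotient_colon_subset [IsNoetherianRing R] (L N : Ideal R) :
    associatedPrimes R (R ⧸ L.colon (N : Set R)) ⊆ associatedPrimes R (R ⧸ L) := by
  intro P hP
  rw [mem_associatedPrimes_quotient_iff] at hP ⊢
  obtain ⟨hP, f, hf⟩ := hP
  obtain ⟨s, hs⟩ := IsNoetherian.noetherian N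
  have key : P = s.inf fun g => L.colon {f * g} := by
    ext r
    simp only [hf, Submodule.mem_finsetInf, Submodule.mem_colon_singleton, smul_eq_mul,
      ← mul_assoc]
    rw [← hs, Submodule.colon_span, Submodule.mem_colon]
    rfl
  obtain ⟨g, -, hg⟩ := Ideal.eq_inf_of_isPrime_inf (key ▸ hP)
  refine ⟨hP, f * g, fun r => ?_⟩
  rw [key, ← hg, Submodule.mem_colon_singleton, smul_eq_mul]

theorem IsIntegrallyClosedIdeal.associatedPrimes_pow_subset [IsDomain R] [IsNoetherianRing R]
    {I : Ideal R} {d : ℕ} (hI : IsIntegrallyClosedIdeal (I ^ d)) (hd : d ≠ 0) {k : ℕ}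
    (hk : d ≤ k) :
    associatedPrimes R (R ⧸ I ^ d) ⊆ associatedPrimes R (R ⧸ I ^ k) := by
  rcases eq_or_ne I ⊥ with rfl | hI0
  · rw [← Ideal.zero_eq_bot, zero_pow hd, zero_pow (by omega)]
  · have := associatedPrimes_quotient_colon_subset (I ^ k) (I ^ (k - d))
    rwa [hI.pow_colon_pow hI0 hk] at this

end Ratliff

/-! ### Monomial valuations and integral dependence. -/

section MonomialValuation

variable {σ K : Type*} [Field K]

/-- The ideal of polynomials all of whose monomials have weight at least `c`. -/
noncomputable def weightIdeal (K : Type*) [Field K] (w : σ → ℕ) (c : ℕ) :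
    Ideal (MvPolynomial σ K) where
  carrier := {f | (c : ℕ∞) ≤ (f : MvPowerSeries σ K).weightedOrder w}
  zero_mem' := by simp
  add_mem' {f g} hf hg := by
    rw [Set.mem_ofPred_eq, coe_add]
    exact (le_min hf hg).trans (MvPowerSeries.min_weightedOrder_le_add w)
  smul_mem' r f hf := by
    rw [Set.mem_ofPred_eq, smul_eq_mul, coe_mul, MvPowerSeries.weightedOrder_mul]
    exact hf.trans le_add_self

theorem mem_weightIdeal {w : σ → ℕ} {c : ℕ} {f : MvPolynomial σ K} :
    f ∈ weightIdeal K w c ↔ (c : ℕ∞) ≤ (f : MvPowerSeries σ K).weightedOrder w :=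
  Iff.rfl

theorem mem_weightIdeal_iff_forall {w : σ → ℕ} {c : ℕ} {f : MvPolynomial σ K} :
    f ∈ weightIdeal K w c ↔ ∀ m ∈ f.support, c ≤ Finsupp.weight w m := by
  rw [mem_weightIdeal]
  constructor
  · intro h m hm
    rw [mem_support_iff, ← coeff_coe] at hm
    exact_mod_cast h.trans (MvPowerSeries.weightedOrder_le w hm)
  · intro h
    refine MvPowerSeries.nat_le_weightedOrder w fun d hd => ?_
    rw [coeff_coe]
    by_contra hne
    exact (h d (mem_support_iff.2 hne)).not_gt hd

theorem pow_le_weightIdeal {w : σ → ℕ} {c : ℕ} {I : Ideal (MvPolynomial σ K)}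
    (h : I ≤ weightIdeal K w c) (n : ℕ) : I ^ n ≤ weightIdeal K w (n * c) := by
  induction n with
  | zero => intro f _; simp [mem_weightIdeal]
  | succ n ih =>
    rw [pow_succ, Ideal.mul_le]
    intro f hf g hg
    rw [mem_weightIdeal, coe_mul, MvPowerSeries.weightedOrder_mul, add_one_mul, Nat.cast_add]
    exact add_le_add (ih hf) (h hg)

/-- Weight ideals are integrally closed: the weighted order is a valuation. -/
theorem IsIntegralOverIdeal.mem_weightIdeal {w : σ → ℕ} {c : ℕ} {I : Ideal (MvPolynomial σ K)}
    (h : I ≤ weightIdeal K w c) {x : MvPolynomial σ K} (hx : IsIntegralOverIdeal I x) :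
    x ∈ weightIdeal K w c := by
  obtain ⟨n, -, a, ha, e⟩ := hx
  by_contra hlt
  rw [_root_.mem_weightIdeal, not_le] at hlt
  obtain ⟨r, hr⟩ := ENat.ne_top_iff_exists.1 hlt.ne_top
  have hrc : r < c := by rw [← hr] at hlt; exact_mod_cast hlt
  have hpow : ∀ k : ℕ, ((x ^ k : MvPolynomial σ K) : MvPowerSeries σ K).weightedOrder w =
      ((k * r : ℕ) : ℕ∞) := by
    intro k
    induction k with
    | zero => simp [MvPowerSeries.weightedOrder_one]
    | succ k ih =>
      rw [pow_succ, coe_mul, MvPowerSeries.weightedOrder_mul, ih, ← hr, add_one_mul, Nat.cast_add]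
  -- Since `i ≥ 1` and `r < c`, each term has order at least `i * c + (n - i) * r > n * r`, so the
  -- sum cannot cancel `x ^ n`.
  have hsum : ∑ i ∈ Finset.Icc 1 n, a i * x ^ (n - i) ∈ weightIdeal K w (n * r + 1) := by
    refine Ideal.sum_mem _ fun i hi => ?_
    have h1 := pow_le_weightIdeal h i (ha i hi)
    rw [_root_.mem_weightIdeal] at h1 ⊢
    rw [coe_mul, MvPowerSeries.weightedOrder_mul, hpow]
    refine le_trans ?_ (add_le_add_left h1 _)
    rw [Finset.mem_Icc] at hi
    obtain ⟨j, rfl⟩ := Nat.exists_eq_add_of_le hi.2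
    norm_cast
    rw [Nat.add_sub_cancel_left]
    nlinarith
  have : x ^ n ∈ weightIdeal K w (n * r + 1) := by
    rw [eq_neg_of_add_eq_zero_left e]
    exact neg_mem hsum
  rw [_root_.mem_weightIdeal, hpow] at this
  have : n * r + 1 ≤ n * r := by exact_mod_cast this
  omega

theorem weight_list_count [DecidableEq σ] (L : List σ) (m : σ →₀ ℕ) :
    Finsupp.weight (fun i => L.count i) m = (L.map m).sum := by
  induction L with
  | nil => simp [Finsupp.weight_apply]
  | cons b L ih =>
    rw [List.map_cons, List.sum_cons, ← ih]
    simp only [Finsupp.weight_apply, List.count_cons, smul_eq_mul, mul_add, Finsupp.sum_add]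
    rw [add_comm]
    congr 1
    simp +contextual [Finsupp.sum]

end MonomialValuation

/-! ### Integral closedness of the square of a cover ideal. -/

section CoverIdeal

variable {σ K : Type*} [Field K] {G : SimpleGraph σ}

theorem mem_vertexCoverIdeal_iff {f : MvPolynomial σ K} :
    f ∈ vertexCoverIdeal K G ↔ ∀ m ∈ f.support, ∀ i j, G.Adj i j → 1 ≤ m i + m j := by
  simp only [vertexCoverIdeal_eq, Ideal.mem_iInf]
  have : ∀ i j, f ∈ Ideal.span {(X i : MvPolynomial σ K), X j} ↔
      ∀ m ∈ f.support, 1 ≤ m i + m j := by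
    intro i j
    rw [← Set.image_pair, mem_ideal_span_X_image]
    refine forall₂_congr fun m _ => ?_
    simp only [Set.mem_insert_iff, Set.mem_singleton_iff, exists_eq_or_imp, exists_eq_left]
    omega
  simp only [this]
  exact ⟨fun h m hm i j hij => h i j hij m hm, fun h i j hij m hm => h m hm i j hij⟩

theorem monomial_mem_vertexCoverIdeal {m : σ →₀ ℕ} (h : ∀ i j, G.Adj i j → 1 ≤ m i + m j) (r : K) :
    monomial m r ∈ vertexCoverIdeal K G := by
  rw [mem_vertexCoverIdeal_iff]
  intro m' hm'
  rwa [Finset.mem_singleton.1 (support_monomial_subset hm')]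

theorem vertexCoverIdeal_ne_bot [Finite σ] : vertexCoverIdeal K G ≠ ⊥ := by
  have h : monomial (Finsupp.equivFunOnFinite.symm fun _ : σ => 1) (1 : K) ∈
      vertexCoverIdeal K G := monomial_mem_vertexCoverIdeal (fun i j _ => by simp) 1
  intro e
  rw [e, Ideal.mem_bot, monomial_eq_zero] at h
  exact one_ne_zero h

/-- A lower bound for all vertex covers on a list of vertices gives a bound for the monomials
integral over a power of the cover ideal. -/
theorem le_sum_of_isIntegralOverIdeal_pow {L : List σ} {c n : ℕ}
    (hL : ∀ m : σ →₀ ℕ, (∀ i j, G.Adj i j → 1 ≤ m i + m j) → c ≤ (L.map m).sum)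
    {f : MvPolynomial σ K} (hf : IsIntegralOverIdeal (vertexCoverIdeal K G ^ n) f)
    {m : σ →₀ ℕ} (hm : m ∈ f.support) : n * c ≤ (L.map m).sum := by
  classical
  have h : vertexCoverIdeal K G ≤ weightIdeal K (fun i => L.count i) c := by
    intro g hg
    rw [mem_weightIdeal_iff_forall]
    intro m hm
    rw [weight_list_count]
    exact hL m (mem_vertexCoverIdeal_iff.1 hg m hm)
  have := mem_weightIdeal_iff_forall.1 (hf.mem_weightIdeal (pow_le_weightIdeal h n)) m hm
  rwa [weight_list_count] at this

/-- The sums telescope; on a closed walk, tails and heads have equal sums. -/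
theorem SimpleGraph.Walk.sum_fst_darts_add {u v : σ} (p : G.Walk u v) (m : σ → ℕ) :
    ((p.darts.map (·.fst)).map m).sum + m v = ((p.darts.map (·.snd)).map m).sum + m u := by
  induction p with
  | nil => simp
  | cons h p ih =>
    simp only [darts_cons, List.map_cons, List.sum_cons]
    omega

theorem SimpleGraph.Walk.length_le_sum_darts {u v : σ} (p : G.Walk u v) {m : σ → ℕ}
    (hm : ∀ i j, G.Adj i j → 1 ≤ m i + m j) :
    p.length ≤ ((p.darts.map (·.fst)).map m).sum + ((p.darts.map (·.snd)).map m).sum := by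
  induction p with
  | nil => simp
  | cons h p ih =>
    have := hm _ _ h
    simp only [darts_cons, List.map_cons, List.sum_cons, length_cons]
    omega

/-- The edges of `G` between vertices of exponent one. -/
def exponentOneGraph (G : SimpleGraph σ) (m : σ →₀ ℕ) : SimpleGraph σ where
  Adj i j := G.Adj i j ∧ m i = 1 ∧ m j = 1
  symm := ⟨fun _ _ h => ⟨h.1.symm, h.2.2, h.2.1⟩⟩
  loopless := ⟨fun _ h => h.1.ne rfl⟩

theorem exponentOneGraph_colorable {f : MvPolynomial σ K}
    (hf : IsIntegralOverIdeal (vertexCoverIdeal K G ^ 2) f) {m : σ →₀ ℕ} (hm : m ∈ f.support) :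
    (exponentOneGraph G m).Colorable 2 := by
  rw [SimpleGraph.two_colorable_iff_forall_loop_even]
  intro u p
  by_contra hodd
  rw [Nat.not_even_iff_odd] at hodd
  obtain ⟨k, hk⟩ := hodd
  -- On a closed walk of length `2k + 1`, twice the vertex sum of a cover is at least `2k + 1`, so
  -- the sum is at least `k + 1` by integrality. Doubling gives `2k + 2`, but here all exponents are
  -- one and sum to `2k + 1`.
  have h := le_sum_of_isIntegralOverIdeal_pow (L := p.darts.map (·.fst)) (c := k + 1) (fun c hc => by
    have h1 := p.length_le_sum_darts (m := c) fun i j hij => hc i j hij.1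
    have h2 := p.sum_fst_darts_add c
    omega) hf hm
  have hone : ((p.darts.map (·.fst)).map m).sum = p.length := by
    rw [← p.length_darts, List.map_map, List.map_congr_left (g := fun _ => 1)
      (fun d _ => d.adj.2.1)]
    simp
  omega

theorem monomial_mem_vertexCoverIdeal_sq [Finite σ] {m : σ →₀ ℕ}
    (hedge : ∀ i j, G.Adj i j → 2 ≤ m i + m j) (hcol : (exponentOneGraph G m).Colorable 2)
    (r : K) : monomial m r ∈ vertexCoverIdeal K G ^ 2 := by
  obtain ⟨C⟩ := hcol
  -- Vertices of exponent at least two join both covers, those of exponent one only the cover of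
  -- their colour. A neighbour of a vertex of exponent zero has exponent at least two.
  let c : Fin 2 → σ →₀ ℕ := fun t => Finsupp.equivFunOnFinite.symm fun i =>
    if 2 ≤ m i ∨ m i = 1 ∧ C i = t then 1 else 0
  have hc : ∀ t i, c t i = if 2 ≤ m i ∨ m i = 1 ∧ C i = t then 1 else 0 := fun _ _ => rfl
  have hcover : ∀ t i j, G.Adj i j → 1 ≤ c t i + c t j := by
    intro t i j hij
    have h := hedge i j hij
    have hne : m i = 1 → m j = 1 → C i ≠ C j := fun h1 h2 => C.valid ⟨hij, h1, h2⟩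
    rw [hc, hc]
    split_ifs <;> grind
  have hle : c 0 + c 1 ≤ m := by
    intro i
    rw [Finsupp.add_apply, hc, hc]
    split_ifs <;> grind
  have e : monomial m r = monomial (c 0) (1 : K) * monomial (c 1) 1 *
      monomial (m - (c 0 + c 1)) r := by
    rw [monomial_mul, monomial_mul, add_tsub_cancel_of_le hle, one_mul, one_mul]
  rw [e, pow_two]
  exact Ideal.mul_mem_right _ _ (Ideal.mul_mem_mul
    (monomial_mem_vertexCoverIdeal (hcover 0) 1) (monomial_mem_vertexCoverIdeal (hcover 1) 1))

theorem isIntegrallyClosedIdeal_vertexCoverIdeal_sq [Finite σ] (G : SimpleGraph σ) :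
    IsIntegrallyClosedIdeal (vertexCoverIdeal K G ^ 2) := by
  refine Set.Subset.antisymm ?_ (subset_idealIntegralClosure _)
  intro f hf
  rw [SetLike.mem_coe, f.as_sum]
  refine Ideal.sum_mem _ fun m hm => monomial_mem_vertexCoverIdeal_sq (fun i j hij => ?_)
    (exponentOneGraph_colorable hf hm) _
  have := le_sum_of_isIntegralOverIdeal_pow (L := [i, j]) (c := 1)
    (fun c hc => by simpa using hc i j hij) hf hm
  simpa using this

end CoverIdeal

theorem corollaryC1 {σ : Type*} [Finite σ] {K : Type*} [Field K] :
    (∀ I : Ideal (MvPolynomial σ K), IsSquareFreeMonomialIdeal I →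
      IsIntegrallyClosedIdeal (I ^ 2) → ∀ k : ℕ, 2 ≤ k →
        (I ≠ ⊥ → (I ^ k).colon ((I ^ (k - 2) : Ideal (MvPolynomial σ K)) :
          Set (MvPolynomial σ K)) = I ^ 2) ∧
        associatedPrimes (MvPolynomial σ K) (MvPolynomial σ K ⧸ I ^ 2) ⊆
          associatedPrimes (MvPolynomial σ K) (MvPolynomial σ K ⧸ I ^ k)) ∧
    (∀ G : SimpleGraph σ, ∀ k : ℕ, 2 ≤ k →
        ((vertexCoverIdeal K G) ^ k).colon
          (((vertexCoverIdeal K G) ^ (k - 2) : Ideal (MvPolynomial σ K)) :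
            Set (MvPolynomial σ K)) = (vertexCoverIdeal K G) ^ 2 ∧
        associatedPrimes (MvPolynomial σ K) (MvPolynomial σ K ⧸ (vertexCoverIdeal K G) ^ 2) ⊆
          associatedPrimes (MvPolynomial σ K)
            (MvPolynomial σ K ⧸ (vertexCoverIdeal K G) ^ k)) := by
  refine ⟨fun I _ hI k hk => ⟨fun hI0 => hI.pow_colon_pow hI0 hk,
    hI.associatedPrimes_pow_subset two_ne_zero hk⟩, fun G k hk => ?_⟩
  have hJ := isIntegrallyClosedIdeal_vertexCoverIdeal_sq (K := K) G
  exact ⟨hJ.pow_colon_pow vertexCoverIdeal_ne_bot hk,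
    hJ.associatedPrimes_pow_subset two_ne_zero hk⟩
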